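/- Let $\omega=\{0,1,2,\dots\}$. A family on $\omega$ is a set $\mathcal F$ of finite subsets of $\omega$ that contains $\emptyset$ and all singletons. It is hereditary if $t\in\mathcal F$ and $s\subseteq t$ imply $s\in\mathcal F$; compact if it is a closed (equivalently compact) subset of $2^\omega$, with the product topology, when each set is identified with its characteristic function; and spreading if $\sigma[s]\in\mathcal F$ whenever $s\in\mathcal F$ and $\sigma:s\to\omega$ is injective with $\sigma(i)\ge i$ for all $i\in s$. It is regular if it is compact, hereditary and spreading. Let $\mathbb K\in\{\mathbb R,\mathbb C\}$. The combinatorial space $X_{\mathcal F}$ is the completion of the space $c_{00}(\omega)$ of finitely supported $\mathbb K$-valued sequences with respect to the norm $$\|x\|=\sup\Big\{\sum_{i\in s}|x(i)| : s\in\mathcal F\Big\},$$ and $X_{\mathcal F}^*$ is its topological dual. Two Banach spaces over $\mathbb K$ are isometric if there is a norm-preserving $\mathbb K$-linear bijection between them. Let $\mathcal F$ and $\mathcal G$ be regular families on $\omega$. Then the following are equivalent: (i) $\mathcal F=\mathcal G$; (ii) $\mathcal F$ and $\mathcal G$ are $\pi$-homeomorphic, that is, there is a permutation $\pi$ of $\omega$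 with $\mathcal G=\{\pi[s]:s\in\mathcal F\}$; (iii) $X_{\mathcal F}$ and $X_{\mathcal G}$ are isometric; (iv) $X_{\mathcal F}^*$ and $X_{\mathcal G}^*$ are isometric. -/

import Mathlib

/-- A family on `ω`: a set of finite subsets of `ω` containing every subset of size at most one. -/
@[ext]
structure OmegaFamily where
  /-- the members of the family -/
  sets : Set (Finset ℕ)
  empty_mem : ∅ ∈ sets
  singleton_mem : ∀ n : ℕ, {n} ∈ sets

namespace OmegaFamily

/-- Closed under subsets. -/
def IsHereditary (F : OmegaFamily) : Prop :=
  ∀ t ∈ F.sets, ∀ s : Finset ℕ, s ⊆ t → s ∈ F.sets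

/-- The characteristic function of a finite set, a point of the Cantor cube `2^ω`
(`Bool` is discrete and `ℕ → Bool` has the product topology). -/
def charFun (s : Finset ℕ) : ℕ → Bool := fun n => decide (n ∈ s)

/-- The family, identified with a set of characteristic functions, is a compact subset
of `2^ω`; as `2^ω` is compact Hausdorff, this is the same as being closed. -/
def IsCompactFamily (F : OmegaFamily) : Prop :=
  IsCompact (charFun '' F.sets)

/-- `t` is a spread of `s`: the image of `s` under an injection `σ : s → ω` such that
`i ≤ σ i` for every `i ∈ s`. -/
def IsSpread (s t : Finset ℕ) : Prop :=
  ∃ σ : ℕ → ℕ, Set.InjOn σ s ∧ (∀ i ∈ s, i ≤ σ i) ∧ s.image σ = t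

/-- Closed under spreads. -/
def IsSpreading (F : OmegaFamily) : Prop :=
  ∀ s ∈ F.sets, ∀ t : Finset ℕ, IsSpread s t → t ∈ F.sets

/-- Regular families: compact, hereditary and spreading. -/
structure IsRegular (F : OmegaFamily) : Prop where
  compact : F.IsCompactFamily
  hereditary : F.IsHereditary
  spreading : F.IsSpreading

/-- `G = π[F] = {π[s] : s ∈ F}` for some permutation `π` of `ω`. -/
def PiHomeomorphic (F G : OmegaFamily) : Prop :=
  ∃ π : Equiv.Perm ℕ, G.sets = (fun s : Finset ℕ => s.image π) '' F.sets

/-- The vector space `c₀₀(ω)` of finitely supported scalar sequences, to be normed by `F`. -/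
def C00 (_F : OmegaFamily) (𝕜 : Type*) [RCLike 𝕜] : Type _ := ℕ →₀ 𝕜

section Norm

variable (F : OmegaFamily) (𝕜 : Type*) [RCLike 𝕜]

noncomputable instance : AddCommGroup (F.C00 𝕜) := inferInstanceAs (AddCommGroup (ℕ →₀ 𝕜))

noncomputable instance : Module 𝕜 (F.C00 𝕜) := inferInstanceAs (Module 𝕜 (ℕ →₀ 𝕜))

instance : FunLike (F.C00 𝕜) ℕ 𝕜 := inferInstanceAs (FunLike (ℕ →₀ 𝕜) ℕ 𝕜)

/-- The norm `‖x‖ = sup {∑_{i ∈ s} |x i| : s ∈ F}`. -/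
noncomputable instance : Norm (F.C00 𝕜) := ⟨fun x => ⨆ s : F.sets, ∑ i ∈ s.1, ‖x i‖⟩

theorem norm_def (x : F.C00 𝕜) : ‖x‖ = ⨆ s : F.sets, ∑ i ∈ s.1, ‖x i‖ := rfl

/-- The supremum that defines the norm is over a bounded set. -/
theorem bddAbove_sums (x : F.C00 𝕜) :
    BddAbove (Set.range fun s : F.sets => ∑ i ∈ s.1, ‖x i‖) := by
  classical
  refine ⟨∑ i ∈ Finsupp.support (M := 𝕜) x, ‖x i‖, ?_⟩
  rintro _ ⟨s, rfl⟩
  calc ∑ i ∈ s.1, ‖x i‖ = ∑ i ∈ s.1 with ‖x i‖ ≠ 0, ‖x i‖ := by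
        rw [Finset.sum_filter_ne_zero]
    _ ≤ ∑ i ∈ Finsupp.support (M := 𝕜) x, ‖x i‖ := by
        refine Finset.sum_le_sum_of_subset_of_nonneg ?_ (fun _ _ _ => norm_nonneg _)
        intro i hi
        exact Finsupp.mem_support_iff.2 (norm_ne_zero_iff.1 (Finset.mem_filter.1 hi).2)

instance : Nonempty F.sets := ⟨⟨∅, F.empty_mem⟩⟩

theorem sum_le_norm (x : F.C00 𝕜) {s : Finset ℕ} (hs : s ∈ F.sets) :
    ∑ i ∈ s, ‖x i‖ ≤ ‖x‖ :=
  le_ciSup (F.bddAbove_sums 𝕜 x) ⟨s, hs⟩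

theorem normCore : NormedSpace.Core 𝕜 (F.C00 𝕜) where
  norm_nonneg x := by simpa using F.sum_le_norm 𝕜 x F.empty_mem
  norm_smul c x := by
    rw [norm_def, norm_def, Real.mul_iSup_of_nonneg (norm_nonneg c)]
    refine iSup_congr fun s => ?_
    rw [Finset.mul_sum]
    exact Finset.sum_congr rfl fun i _ => norm_mul c (x i)
  norm_triangle x y := by
    refine ciSup_le fun s => ?_
    calc ∑ i ∈ s.1, ‖(x + y) i‖ ≤ ∑ i ∈ s.1, (‖x i‖ + ‖y i‖) :=
          Finset.sum_le_sum fun i _ => norm_add_le (x i) (y i)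
      _ = ∑ i ∈ s.1, ‖x i‖ + ∑ i ∈ s.1, ‖y i‖ := Finset.sum_add_distrib
      _ ≤ ‖x‖ + ‖y‖ := add_le_add (F.sum_le_norm 𝕜 x s.2) (F.sum_le_norm 𝕜 y s.2)
  norm_eq_zero_iff x := by
    constructor
    · intro h
      refine DFunLike.ext (F := ℕ →₀ 𝕜) _ _ fun i => ?_
      have h1 := F.sum_le_norm 𝕜 x (F.singleton_mem i)
      rw [h, Finset.sum_singleton] at h1
      exact norm_le_zero_iff.1 h1
    · rintro rfl
      rw [norm_def]
      have h0 : ∀ i, (0 : F.C00 𝕜) i = 0 := fun i => rfl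
      simp [h0]

noncomputable instance : NormedAddCommGroup (F.C00 𝕜) :=
  NormedAddCommGroup.ofCore (F.normCore 𝕜)

noncomputable instance : NormedSpace 𝕜 (F.C00 𝕜) :=
  NormedSpace.ofCore (F.normCore 𝕜)

/-- The combinatorial Banach space `X_F`: the completion of `c₀₀(ω)` in the norm given by `F`. -/
abbrev CombSpace : Type _ := UniformSpace.Completion (F.C00 𝕜)

end Norm

end OmegaFamily

/-!
Only two implications have content: a `π`-homeomorphism of regular families forces equality, and an
isometry of the dual spaces forces a `π`-homeomorphism.

*Rigidity of spreading families.* Let `π` be a permutation with `π[F] = G`. For every finite set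
`s` there is a finite set `t` such that `t` is a spread of `s` and `s` is a spread of `π[t]`
(`exists_isSpread_and_isSpread_image`). If `s ∈ F`, then `t ∈ F`, so `π[t] ∈ G`, so `s ∈ G`. The set
`t` is built by induction on the maximum `a` of `s`: the new element is the largest point outside
the set already built that `π` sends to a point `≤ a`, and counting points below each threshold
shows that it is large enough.

*Extreme points of the dual ball.* A functional on `X_F` is determined by its coordinates
`f (e i)`. The sequences of coordinates of functionals of norm at most one form a compact convex
subset of the product `ℕ → 𝕜`, and Hahn–Banach separation identifies it with the closed convex hull
of the compact set of sequences that are unimodular on some `s ∈ F` and zero elsewhere. By Milman's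
converse to the Krein–Milman theorem every extreme point is such a sequence; it is extreme exactly
when `s` is a maximal member of `F` (`isBallExtreme_iff`).

*Isometries of the duals.* Let `T` be an isometry from `X_F^*` onto `X_G^*` and let `x i` be the
sequence of coordinates of the image of the `i`-th coordinate functional. As `T` preserves extreme
points, every unimodular combination of the `x i` with `i` in a maximal member of `F` has
coordinates of modulus `0` or `1`, with a maximal member of `G` as support (`MapsMaximal`).
Changing one coefficient at a time, this leaves two possibilities at each coordinate: either at
most one of the `x i` is nonzero there, or (for real scalars) two of them take the values `± 1 / 2`,
as under the rotation of `ℓ_1^2` onto `ℓ_∞^2`. Regularity excludes the second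
(`MapsMaximal.norm_ne_half`): spreading produces infinitely many `m` with `|x m c| = 1 / 2`, three of
which never lie in a common member, so `F` has no member with three elements; but then two of
these `m`, `m'` have the same pattern of signs, and the support of `x m - x m'` is strictly
contained in that of `x m + x m'`, although both are maximal in `G`. Hence the `x i` with `i` in a
common member have disjoint supports, and the same holds for the inverse of `T`. Expanding
a coordinate functional through `T` and its inverse, each `x i` lives on a single point `π i`, and
`π` is the required permutation.
-/

open scoped ComplexConjugate
open UniformSpace

/-! ### Maximal members and rigidity of spreading families -/

namespace OmegaFamily

/-- Otherwise there is a strictly increasing sequence of members, whose characteristic functions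
converge to that of an infinite set; but by compactness the limit belongs to the family. -/
theorem exists_maximal_superset {F : OmegaFamily} (hF : F.IsCompactFamily)
    {p : Finset ℕ → Prop} {s : Finset ℕ} (hs : s ∈ F.sets) (hp : p s) :
    ∃ t, s ⊆ t ∧ Maximal (fun t => t ∈ F.sets ∧ p t) t := by
  classical
  by_contra! hcon
  have hstep : ∀ t : {t : Finset ℕ // s ⊆ t ∧ t ∈ F.sets ∧ p t},
      ∃ t' : {t : Finset ℕ // s ⊆ t ∧ t ∈ F.sets ∧ p t}, t.1 ⊂ t'.1 := by
    rintro ⟨t, hst, ht⟩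
    have h := hcon t hst
    simp only [Maximal, not_and, not_forall] at h
    obtain ⟨u, hu, htu, hut⟩ := h ht
    exact ⟨⟨u, hst.trans htu, hu⟩, htu, hut⟩
  choose g hg using hstep
  let u : ℕ → {t : Finset ℕ // s ⊆ t ∧ t ∈ F.sets ∧ p t} := fun n => g^[n] ⟨s, subset_rfl, hs, hp⟩
  have hu : StrictMono fun n => (u n).1 := by
    refine strictMono_nat_of_lt_succ fun n => ?_
    simp only [u, Function.iterate_succ_apply']
    exact hg _
  have hlim : Filter.Tendsto (fun n => charFun (u n).1) Filter.atTop
      (nhds fun i => decide (∃ n, i ∈ (u n).1)) := by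
    refine tendsto_pi_nhds.2 fun i => tendsto_const_nhds.congr' ?_
    by_cases hi : ∃ n, i ∈ (u n).1
    · obtain ⟨n, hn⟩ := hi
      filter_upwards [Filter.eventually_ge_atTop n] with m hm
      have h1 : i ∈ (u m).1 := hu.monotone hm hn
      have h2 : ∃ n, i ∈ (u n).1 := ⟨n, hn⟩
      simp [charFun, h1, h2]
    · refine Filter.Eventually.of_forall fun m => ?_
      have h1 : i ∉ (u m).1 := fun h => hi ⟨m, h⟩
      simp only [charFun, hi, h1]
  obtain ⟨t, -, ht⟩ := hF.isClosed.mem_of_tendsto hlim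
    (Filter.Eventually.of_forall fun n => ⟨(u n).1, (u n).2.2.1, rfl⟩)
  have hsub : ∀ n, (u n).1 ⊆ t := fun n i hi => by
    have h1 := congrFun ht i
    have h2 : ∃ n, i ∈ (u n).1 := ⟨n, hi⟩
    rw [decide_eq_true h2] at h1
    exact of_decide_eq_true h1
  have hcard : ∀ n, n ≤ (u n).1.card := fun n => (Finset.card_strictMono.comp hu).le_apply
  have := (hcard (t.card + 1)).trans (Finset.card_le_card (hsub _))
  omega

theorem exists_maximal {F : OmegaFamily} (hF : F.IsCompactFamily) {s : Finset ℕ}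
    (hs : s ∈ F.sets) : ∃ t, s ⊆ t ∧ Maximal (· ∈ F.sets) t := by
  simpa using exists_maximal_superset hF (p := fun _ => True) hs trivial

theorem IsSpread.insert {s t : Finset ℕ} {a b : ℕ} (h : IsSpread s t) (ha : a ∉ s) (hb : b ∉ t)
    (hab : a ≤ b) : IsSpread (insert a s) (insert b t) := by
  obtain ⟨σ, hinj, hle, rfl⟩ := h
  have hne : ∀ i ∈ s, i ≠ a := fun i hi h => ha (h ▸ hi)
  have hσ : ∀ i ∈ s, Function.update σ a b i = σ i := fun i hi =>
    Function.update_of_ne (hne i hi) _ _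
  refine ⟨Function.update σ a b, ?_, ?_, ?_⟩
  · rw [Finset.coe_insert, Set.injOn_insert (by simpa using ha)]
    refine ⟨hinj.congr fun i hi => (hσ i hi).symm, ?_⟩
    rintro ⟨i, hi, h⟩
    rw [hσ i hi, Function.update_self] at h
    exact hb (h ▸ Finset.mem_image_of_mem σ hi)
  · intro i hi
    rcases Finset.mem_insert.1 hi with rfl | hi
    · simpa using hab
    · rw [hσ i hi]
      exact hle i hi
  · rw [Finset.image_insert, Function.update_self, Finset.image_congr fun i hi => hσ i hi]

theorem isSpread_refl (s : Finset ℕ) : IsSpread s s :=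
  ⟨id, Set.injOn_id _, fun _ _ => le_rfl, Finset.image_id⟩

/-- The order-preserving bijection from `s` onto `t` moves no point to the left if below every `m`
there are at most as many points of `t` as of `s`. -/
theorem isSpread_of_card_filter_le {s t : Finset ℕ} (hcard : t.card = s.card)
    (hle : ∀ m, (t.filter (· < m)).card ≤ (s.filter (· < m)).card) : IsSpread s t := by
  induction s using Finset.induction_on_max generalizing t with
  | empty =>
    obtain rfl : t = ∅ := by simpa using hcard
    exact isSpread_refl ∅
  | insert a s hmax ih =>
    have ha : a ∉ s := fun h => (hmax a h).false
    rw [Finset.card_insert_of_notMem ha] at hcard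
    have htne : t.Nonempty := Finset.card_pos.1 (by omega)
    have hb := t.max'_mem htne
    set b := t.max' htne with hbdef
    have htb : ∀ x ∈ t, x ≤ b := fun x hx => t.le_max' x hx
    have hsm : ∀ m, m ≤ a → (insert a s).filter (· < m) = s.filter (· < m) := fun m hm =>
      Finset.filter_insert _ _ _ |>.trans (if_neg (by omega))
    have hab : a ≤ b := by
      by_contra! hlt
      have h1 := hle a
      rw [hsm a le_rfl, Finset.filter_true_of_mem (fun x hx => (htb x hx).trans_lt hlt)] at h1
      have := Finset.card_filter_le s (· < a)
      omega
    have hcard' : (t.erase b).card = s.card := by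
      rw [Finset.card_erase_of_mem hb]
      omega
    have := (ih hcard' fun m => ?_).insert ha (Finset.notMem_erase b t) hab
    · rwa [Finset.insert_erase hb] at this
    rcases le_or_gt m a with hm | hm
    · rw [← hsm m hm]
      exact (Finset.card_le_card (Finset.filter_subset_filter _ (Finset.erase_subset _ _))).trans
        (hle m)
    · rw [Finset.filter_true_of_mem (s := s) fun x hx => (hmax x hx).trans hm, ← hcard']
      exact Finset.card_filter_le _ _

/-- The combinatorial core of the rigidity of spreading families. Both conditions compare the sets
through possibly different bijections; a single bijection `s → t` would not do in general. -/
theorem exists_isSpread_and_isSpread_image (π : Equiv.Perm ℕ) (s : Finset ℕ) :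
    ∃ t, IsSpread s t ∧ IsSpread (t.image π) s := by
  suffices h : ∃ t : Finset ℕ, t.card = s.card ∧
      (∀ m, (t.filter (· < m)).card ≤ (s.filter (· < m)).card) ∧ IsSpread (t.image π) s by
    obtain ⟨t, h1, h2, h3⟩ := h
    exact ⟨t, isSpread_of_card_filter_le h1 h2, h3⟩
  induction s using Finset.induction_on_max with
  | empty => exact ⟨∅, rfl, fun _ => le_rfl, isSpread_refl ∅⟩
  | insert a s hmax ih =>
    obtain ⟨t, hcard, hle, hspread⟩ := ih
    have ha : a ∉ s := fun h => (hmax a h).false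
    have hsa : ∀ m, (s.filter fun x => ¬ x < m).card ≤ a - m := fun m => by
      rw [← Nat.card_Ico]
      refine Finset.card_le_card fun x hx => ?_
      simp only [Finset.mem_filter, not_lt] at hx
      exact Finset.mem_Ico.2 ⟨hx.2, hmax x hx.1⟩
    have hs_card : s.card ≤ a := by simpa using hsa 0
    -- the positions that `π` sends below `a + 1`
    let P := (Finset.range (a + 1)).image π.symm
    have hP : P.card = a + 1 := by
      rw [Finset.card_image_of_injective _ π.symm.injective, Finset.card_range]
    have hmemP : ∀ x, x ∈ P ↔ π x ≤ a := fun x => by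
      simp only [P, Finset.mem_image, Finset.mem_range, Nat.lt_succ_iff]
      exact ⟨by rintro ⟨y, hy, rfl⟩; simpa, fun h => ⟨π x, h, by simp⟩⟩
    have hne : (P \ t).Nonempty := by
      rw [← Finset.card_pos]
      have := Finset.le_card_sdiff t P
      omega
    -- the largest admissible new element
    have hb := (P \ t).max'_mem hne
    have hbmax : ∀ x ∈ P \ t, x ≤ (P \ t).max' hne := fun x hx => Finset.le_max' _ x hx
    generalize (P \ t).max' hne = b at hb hbmax
    rw [Finset.mem_sdiff] at hb
    refine ⟨insert b t, ?_, fun m => ?_, ?_⟩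
    · rw [Finset.card_insert_of_notMem hb.2, Finset.card_insert_of_notMem ha, hcard]
    · have hss : (s.filter (· < m)).card ≤ ((insert a s).filter (· < m)).card :=
        Finset.card_le_card (Finset.filter_subset_filter _ (Finset.subset_insert _ _))
      rcases le_or_gt m b with hm | hm
      · rw [Finset.filter_insert, if_neg (by omega)]
        exact (hle m).trans hss
      rcases lt_or_ge a m with ham | ham
      · rw [Finset.filter_true_of_mem (s := insert a s)]
        · refine (Finset.card_filter_le _ _).trans (le_of_eq ?_)
          rw [Finset.card_insert_of_notMem hb.2, Finset.card_insert_of_notMem ha, hcard]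
        · intro x hx
          rcases Finset.mem_insert.1 hx with rfl | hx
          · exact ham
          · exact (hmax x hx).trans ham
      · rw [Finset.filter_insert, if_pos hm, Finset.card_insert_of_notMem (by simp [hb.2])]
        -- by the choice of `b`, all points of `P` from `m` on lie in `t`
        have h1 : (P.filter fun x => ¬ x < m).card ≤ (t.filter fun x => ¬ x < m).card := by
          refine Finset.card_le_card fun x hx => ?_
          simp only [Finset.mem_filter] at hx ⊢
          refine ⟨by_contra fun hxt => ?_, hx.2⟩
          have := hbmax x (Finset.mem_sdiff.2 ⟨hx.1, hxt⟩)
          omega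
        have h2 : (P.filter (· < m)).card ≤ m := by
          conv_rhs => rw [← Finset.card_range m]
          refine Finset.card_le_card fun x hx => ?_
          simp only [Finset.mem_filter] at hx
          exact Finset.mem_range.2 hx.2
        have h3 := Finset.card_filter_add_card_filter_not (s := P) (· < m)
        have h4 := Finset.card_filter_add_card_filter_not (s := t) (· < m)
        have h5 := Finset.card_filter_add_card_filter_not (s := s) (· < m)
        have h6 := hsa m
        omega
    · rw [Finset.image_insert]
      exact hspread.insert (fun h => hb.2 (by simpa using h)) ha ((hmemP b).1 hb.1)

theorem PiHomeomorphic.symm {F G : OmegaFamily} (h : F.PiHomeomorphic G) :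
    G.PiHomeomorphic F := by
  obtain ⟨π, hπ⟩ := h
  refine ⟨π.symm, ?_⟩
  rw [hπ, Set.image_image]
  simp [Finset.image_image]

theorem PiHomeomorphic.subset {F G : OmegaFamily} (h : F.PiHomeomorphic G) (hF : F.IsSpreading)
    (hG : G.IsSpreading) : F.sets ⊆ G.sets := by
  obtain ⟨π, hπ⟩ := h
  intro s hs
  obtain ⟨t, hst, hts⟩ := exists_isSpread_and_isSpread_image π s
  exact hG _ (hπ ▸ ⟨t, hF s hs t hst, rfl⟩) s hts

/-- A spreading family is the only spreading family in its class up to permutations of `ω`. -/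
theorem PiHomeomorphic.eq {F G : OmegaFamily} (h : F.PiHomeomorphic G) (hF : F.IsSpreading)
    (hG : G.IsSpreading) : F = G :=
  OmegaFamily.ext ((h.subset hF hG).antisymm (h.symm.subset hG hF))

end OmegaFamily

/-! ### Milman's converse to the Krein–Milman theorem -/

theorem IsCompact.convexJoin {E : Type*} [AddCommGroup E] [Module ℝ E] [TopologicalSpace E]
    [ContinuousAdd E] [ContinuousSMul ℝ E] {s t : Set E} (hs : IsCompact s) (ht : IsCompact t) :
    IsCompact (convexJoin ℝ s t) := by
  have h := ((isCompact_Icc (a := (0 : ℝ)) (b := 1)).prod (hs.prod ht)).image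
    (f := fun p : ℝ × E × E => (1 - p.1) • p.2.1 + p.1 • p.2.2) (by fun_prop)
  convert h using 1
  ext x
  simp only [mem_convexJoin, segment_eq_image, Set.mem_image, Prod.exists, Set.mem_prod]
  constructor
  · rintro ⟨a, ha, b, hb, θ, hθ, rfl⟩
    exact ⟨θ, a, b, ⟨hθ, ha, hb⟩, rfl⟩
  · rintro ⟨θ, a, b, ⟨hθ, ha, hb⟩, rfl⟩
    exact ⟨a, ha, b, hb, θ, hθ, rfl⟩

/-- If no `d ≠ 0` has both `x + d` and `x - d` in the convex set `D`, then `x` is only in trivial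
segments of `D`. -/
theorem eq_or_eq_of_mem_segment {E : Type*} [AddCommGroup E] [Module ℝ E] {D : Set E}
    (hD : Convex ℝ D) {x a b : E} (hx : ∀ d, x + d ∈ D → x - d ∈ D → d = 0) (ha : a ∈ D)
    (hb : b ∈ D) (h : x ∈ segment ℝ a b) : x = a ∨ x = b := by
  wlog hle : ∃ θ : ℝ, 0 ≤ θ ∧ θ ≤ 1 / 2 ∧ x = (1 - θ) • a + θ • b generalizing a b
  · obtain ⟨θ, ⟨h0, h1⟩, hxθ⟩ := segment_eq_image ℝ a b ▸ h
    have hθ : ¬ θ ≤ 1 / 2 := fun hθ => hle ⟨θ, h0, hθ, hxθ.symm⟩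
    exact (this hb ha (by rwa [segment_symm])
      ⟨1 - θ, by linarith, by linarith, by rw [← hxθ]; module⟩).symm
  obtain ⟨θ, h0, h1, rfl⟩ := hle
  left
  have h := hx (θ • (b - a)) ?_ ?_
  · rw [show (1 - θ) • a + θ • b = a + θ • (b - a) by module, h, add_zero]
  · rw [show (1 - θ) • a + θ • b + θ • (b - a) = (1 - 2 * θ) • a + (2 * θ) • b by module]
    exact hD ha hb (by linarith) (by linarith) (by ring)
  · rwa [show (1 - θ) • a + θ • b - θ • (b - a) = a by module]

/-- **Milman's theorem**: an extreme point of a compact closed convex hull `D` of a compact set `K`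
lies in `K`. Extremality is expressed by the absence of `d ≠ 0` with `x + d` and `x - d` in `D`. If
`A` and `B` cover `K`, then `D` is contained in the convex join of the closed convex hulls of `K ∩
A` and `K ∩ B`, so `x` belongs to one of these hulls; by compactness this contradicts the existence
of small convex neighbourhoods. -/
theorem IsCompact.mem_of_extreme_closedConvexHull {E : Type*} [AddCommGroup E] [Module ℝ E]
    [TopologicalSpace E] [IsTopologicalAddGroup E] [ContinuousSMul ℝ E] [LocallyConvexSpace ℝ E]
    [T2Space E] {K : Set E} (hK : IsCompact K) (hD : IsCompact (closedConvexHull ℝ K)) {x : E}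
    (hxD : x ∈ closedConvexHull ℝ K)
    (hx : ∀ d, x + d ∈ closedConvexHull ℝ K → x - d ∈ closedConvexHull ℝ K → d = 0) :
    x ∈ K := by
  by_contra hxK
  have hsub : ∀ S : Set E, closedConvexHull ℝ (K ∩ S) ⊆ closedConvexHull ℝ K := fun S =>
    (closedConvexHull ℝ).monotone Set.inter_subset_left
  refine (hK.induction_on (p := fun S => x ∉ closedConvexHull ℝ (K ∩ S)) ?_ ?_ ?_ ?_)
    (by rwa [Set.inter_self])
  · rw [Set.inter_empty]
    exact fun h => closedConvexHull_min subset_rfl convex_empty isClosed_empty h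
  · intro S T hST hT hS
    exact hT ((closedConvexHull ℝ).monotone (Set.inter_subset_inter_right _ hST) hS)
  · intro S T hS hT hST
    have hc : ∀ S : Set E, IsCompact (closedConvexHull ℝ (K ∩ S)) := fun S =>
      hD.of_isClosed_subset isClosed_closedConvexHull (hsub S)
    rcases (K ∩ S).eq_empty_or_nonempty with h0 | h0
    · rw [Set.inter_union_distrib_left, h0, Set.empty_union] at hST
      exact hT hST
    rcases (K ∩ T).eq_empty_or_nonempty with h1 | h1
    · rw [Set.inter_union_distrib_left, h1, Set.union_empty] at hST
      exact hS hST
    have hjoin : closedConvexHull ℝ (K ∩ (S ∪ T)) ⊆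
        _root_.convexJoin ℝ (closedConvexHull ℝ (K ∩ S)) (closedConvexHull ℝ (K ∩ T)) := by
      refine closedConvexHull_min ?_ (convex_closedConvexHull.convexJoin convex_closedConvexHull)
        ((hc S).convexJoin (hc T)).isClosed
      rw [Set.inter_union_distrib_left]
      exact Set.union_subset
        ((subset_closedConvexHull).trans
          (subset_convexJoin_left (h1.mono subset_closedConvexHull)))
        ((subset_closedConvexHull).trans
          (subset_convexJoin_right (h0.mono subset_closedConvexHull)))
    obtain ⟨a, ha, b, hb, hab⟩ := mem_convexJoin.1 (hjoin hST)
    rcases eq_or_eq_of_mem_segment convex_closedConvexHull hx (hsub S ha) (hsub T hb) hab with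
      rfl | rfl
    · exact hS ha
    · exact hT hb
  · intro y hy
    have hyx : ({x}ᶜ : Set E) ∈ nhds y := isOpen_compl_singleton.mem_nhds fun h => hxK (h ▸ hy)
    obtain ⟨C, hCy, hCc, hCx⟩ := exists_mem_nhds_isClosed_subset hyx
    obtain ⟨V, ⟨hVy, hVc⟩, hVC⟩ := (LocallyConvexSpace.convex_basis (𝕜 := ℝ) y).mem_iff.1 hCy
    refine ⟨V, mem_nhdsWithin_of_mem_nhds hVy, fun hxV => ?_⟩
    have : closedConvexHull ℝ (K ∩ V) ⊆ C :=
      (closedConvexHull_min (Set.inter_subset_right.trans subset_closure) hVc.closure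
        isClosed_closure).trans (closure_minimal hVC hCc)
    exact hCx (this hxV) rfl

/-! ### Families of sequences whose unimodular sums are supported on maximal members -/

/-- The second alternative, which includes the phenomenon `1 / 2 ± 1 / 2 ∈ {0, 1}`, is possible only
for real scalars: for complex ones the coefficients `± I` exclude it. -/
theorem RCLike.mul_eq_zero_or_norm_eq_half {𝕜 : Type*} [RCLike 𝕜] {a w : 𝕜}
    (h : ∀ z : 𝕜, ‖z‖ = 1 → ‖a + z * w‖ = 0 ∨ ‖a + z * w‖ = 1) :
    a * w = 0 ∨ ‖a‖ = 1 / 2 ∧ (w = a ∨ w = -a) := by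
  have hdouble : ‖a + a‖ = 0 ∨ ‖a + a‖ = 1 → a = 0 ∨ ‖a‖ = 1 / 2 := by
    rw [← two_mul, norm_mul, RCLike.norm_two]
    rintro (h | h)
    · exact .inl (norm_eq_zero.1 (by linarith))
    · exact .inr (by linarith)
  have hadd := h 1 norm_one
  have hsub := h (-1) (by rw [norm_neg, norm_one])
  rw [one_mul] at hadd
  rw [neg_one_mul] at hsub
  rcases hadd with hadd | hadd
  · obtain rfl : w = -a := by
      rw [norm_eq_zero] at hadd
      exact (neg_eq_of_add_eq_zero_right hadd).symm
    rw [neg_neg] at hsub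
    exact (hdouble hsub).imp (fun h0 => by simp [h0]) fun h1 => ⟨h1, .inr rfl⟩
  rcases hsub with hsub | hsub
  · obtain rfl : w = a := by
      rw [norm_eq_zero, ← sub_eq_add_neg, sub_eq_zero] at hsub
      exact hsub.symm
    exact (hdouble (.inr hadd)).imp (fun h0 => by simp [h0]) fun h1 => ⟨h1, .inl rfl⟩
  left
  have key : ∀ z : 𝕜, ‖a + z‖ ^ 2 = ‖a‖ ^ 2 + ‖z‖ ^ 2 + 2 * RCLike.re (a * conj z) := fun z => by
    simpa only [RCLike.normSq_eq_def'] using RCLike.normSq_add a z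
  have h1 := key w
  have h2 := key (-w)
  rw [hadd] at h1
  rw [hsub, norm_neg, map_neg, mul_neg, map_neg] at h2
  have hre : RCLike.re (a * conj w) = 0 := by linarith
  have him : RCLike.im (a * conj w) = 0 := by
    by_cases hI : (RCLike.I : 𝕜) = 0
    · have := RCLike.mul_im_I_ax (a * conj w)
      rw [hI, map_zero, mul_zero] at this
      exact this.symm
    · have hsq : ∀ z : 𝕜, ‖z‖ = 1 → ‖a + z * w‖ ^ 2 ≤ 1 := fun z hz => by
        rcases h z hz with h | h <;> rw [h] <;> norm_num
      have h3 := hsq RCLike.I (RCLike.norm_I_of_ne_zero hI)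
      have h4 := hsq (-RCLike.I) (by rw [norm_neg, RCLike.norm_I_of_ne_zero hI])
      rw [key, norm_mul, RCLike.norm_I_of_ne_zero hI, one_mul, map_mul (starRingEnd 𝕜), RCLike.conj_I,
        mul_left_comm, neg_mul, map_neg, RCLike.I_mul_re] at h3
      rw [key, norm_mul, norm_neg, RCLike.norm_I_of_ne_zero hI, one_mul, map_mul (starRingEnd 𝕜), map_neg,
        RCLike.conj_I, neg_neg, mul_left_comm, RCLike.I_mul_re] at h4
      linarith
  have h0 : a * conj w = 0 := by
    rw [← RCLike.re_add_im (a * conj w), hre, him]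
    simp
  rcases mul_eq_zero.1 h0 with h0 | h0
  · rw [h0, zero_mul]
  · rw [(map_eq_zero _).1 h0, mul_zero]

/-- Changing the sign of one coefficient isolates the corresponding term. -/
theorem eq_zero_of_forall_unimodular_sum_eq_zero {𝕜 : Type*} [RCLike 𝕜] {u : Finset ℕ} {y : ℕ → 𝕜}
    (h : ∀ ε : ℕ → 𝕜, (∀ i, ‖ε i‖ = 1) → ∑ j ∈ u, ε j * y j = 0) : ∀ j ∈ u, y j = 0 := by
  intro j hj
  have h1 := h (fun _ => 1) fun _ => norm_one
  have h2 := h (Function.update (fun _ => 1) j (-1)) fun i => by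
    by_cases hi : i = j <;> simp [hi]
  rw [← Finset.add_sum_erase _ _ hj] at h1 h2
  rw [Function.update_self, Finset.sum_congr rfl fun i hi => by
    rw [Function.update_of_ne (Finset.ne_of_mem_erase hi)]] at h2
  have : (2 : 𝕜) * y j = 0 := by linear_combination h1 - h2
  simpa using this

namespace OmegaFamily

variable {𝕜 : Type*} [RCLike 𝕜] {F G : OmegaFamily} {x y : ℕ → ℕ → 𝕜}

/-- The sequences `x i`, combined with unimodular coefficients over a maximal member of `F`, always
give a sequence that is unimodular on a maximal member of `G` and zero elsewhere. -/
def MapsMaximal (F G : OmegaFamily) (x : ℕ → ℕ → 𝕜) : Prop :=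
  ∀ s, Maximal (· ∈ F.sets) s → ∀ ε : ℕ → 𝕜, (∀ i, ‖ε i‖ = 1) →
    ∃ t, Maximal (· ∈ G.sets) t ∧ ∀ c, ‖∑ i ∈ s, ε i * x i c‖ = if c ∈ t then 1 else 0

/-- The product of the infinite matrices `x` and `y` is the identity. The sum over `c` is taken over
any finite set that contains the support of the row `x i`; nothing is claimed for rows of infinite
support. -/
def IsLeftInverse (x y : ℕ → ℕ → 𝕜) : Prop :=
  ∀ i (t : Finset ℕ), (∀ c, x i c ≠ 0 → c ∈ t) →
    ∀ k, ∑ c ∈ t, x i c * y c k = if k = i then 1 else 0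

namespace MapsMaximal

theorem norm_sum_eq (h : MapsMaximal F G x) {s : Finset ℕ} (hs : Maximal (· ∈ F.sets) s)
    {ε : ℕ → 𝕜} (hε : ∀ i, ‖ε i‖ = 1) (c : ℕ) :
    ‖∑ i ∈ s, ε i * x i c‖ = 0 ∨ ‖∑ i ∈ s, ε i * x i c‖ = 1 := by
  obtain ⟨t, -, ht⟩ := h s hs ε hε
  rw [ht c]
  split_ifs <;> simp

theorem norm_add_mul_sum_erase (h : MapsMaximal F G x) {s : Finset ℕ}
    (hs : Maximal (· ∈ F.sets) s) {i : ℕ} (hi : i ∈ s) {ε : ℕ → 𝕜} (hε : ∀ i, ‖ε i‖ = 1) (c : ℕ)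
    {z : 𝕜} (hz : ‖z‖ = 1) :
    ‖x i c + z * ∑ j ∈ s.erase i, ε j * x j c‖ = 0 ∨
      ‖x i c + z * ∑ j ∈ s.erase i, ε j * x j c‖ = 1 := by
  have := h.norm_sum_eq hs (ε := Function.update (fun j => z * ε j) i 1) (fun j => by
    by_cases hj : j = i <;> simp [hj, hz, hε]) c
  rw [← Finset.add_sum_erase _ _ hi, Function.update_self, one_mul, Finset.sum_congr rfl
    fun j hj => by rw [Function.update_of_ne (Finset.ne_of_mem_erase hj), mul_assoc],
    ← Finset.mul_sum] at this
  exact this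

theorem mul_sum_erase_eq_zero_or (h : MapsMaximal F G x) {s : Finset ℕ}
    (hs : Maximal (· ∈ F.sets) s) {i : ℕ} (hi : i ∈ s) {ε : ℕ → 𝕜} (hε : ∀ i, ‖ε i‖ = 1)
    (c : ℕ) :
    x i c * ∑ j ∈ s.erase i, ε j * x j c = 0 ∨
      ‖x i c‖ = 1 / 2 ∧ (∑ j ∈ s.erase i, ε j * x j c = x i c ∨
        ∑ j ∈ s.erase i, ε j * x j c = -x i c) :=
  RCLike.mul_eq_zero_or_norm_eq_half fun _ hz => h.norm_add_mul_sum_erase hs hi hε c hz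

/-- At a coordinate where `x i` is nonzero and not of modulus `1 / 2`, all other members vanish. -/
theorem eq_zero_of_norm_ne_half (h : MapsMaximal F G x) {s : Finset ℕ}
    (hs : Maximal (· ∈ F.sets) s) {i k : ℕ} (hi : i ∈ s) (hk : k ∈ s) (hik : k ≠ i) {c : ℕ}
    (h0 : x i c ≠ 0) (h2 : ‖x i c‖ ≠ 1 / 2) : x k c = 0 :=
  eq_zero_of_forall_unimodular_sum_eq_zero (u := s.erase i) (y := fun j => x j c)
    (fun _ hε => ((mul_eq_zero.1 ((h.mul_sum_erase_eq_zero_or hs hi hε c).resolve_right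
      fun h' => h2 h'.1)).resolve_left h0)) k (Finset.mem_erase.2 ⟨hik, hk⟩)

/-- At a coordinate where `x i` has modulus `1 / 2`, the others must compensate for it. -/
theorem sum_erase_eq_or_eq_neg (h : MapsMaximal F G x) {s : Finset ℕ}
    (hs : Maximal (· ∈ F.sets) s) {i : ℕ} (hi : i ∈ s) {c : ℕ} (h2 : ‖x i c‖ = 1 / 2)
    {ε : ℕ → 𝕜} (hε : ∀ i, ‖ε i‖ = 1) :
    ∑ j ∈ s.erase i, ε j * x j c = x i c ∨ ∑ j ∈ s.erase i, ε j * x j c = -x i c := by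
  rcases h.mul_sum_erase_eq_zero_or hs hi hε c with h0 | h0
  · have hx : x i c ≠ 0 := fun hx => by norm_num [hx] at h2
    have h1 := h.norm_add_mul_sum_erase hs hi hε c norm_one
    rw [(mul_eq_zero.1 h0).resolve_left hx, mul_zero, add_zero, h2] at h1
    norm_num at h1
  · exact h0.2

theorem exists_ne_norm_eq_half (h : MapsMaximal F G x) {s : Finset ℕ}
    (hs : Maximal (· ∈ F.sets) s) {i : ℕ} (hi : i ∈ s) {c : ℕ} (h2 : ‖x i c‖ = 1 / 2) :
    ∃ k ∈ s, k ≠ i ∧ ‖x k c‖ = 1 / 2 := by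
  have hx : x i c ≠ 0 := fun hx => by norm_num [hx] at h2
  have hne : ∑ j ∈ s.erase i, (1 : 𝕜) * x j c ≠ 0 := by
    rcases h.sum_erase_eq_or_eq_neg hs hi h2 (ε := fun _ => 1) (fun _ => norm_one) with h | h <;>
      rw [h]
    · exact hx
    · exact neg_ne_zero.2 hx
  obtain ⟨k, hk, hk0⟩ := Finset.exists_ne_zero_of_sum_ne_zero hne
  rw [one_mul] at hk0
  rw [Finset.mem_erase] at hk
  refine ⟨k, hk.2, hk.1, by_contra fun hk2 => ?_⟩
  exact hx (h.eq_zero_of_norm_ne_half hs hk.2 hi hk.1.symm hk0 hk2)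

theorem eq_zero_of_norm_eq_half (h : MapsMaximal F G x) {s : Finset ℕ}
    (hs : Maximal (· ∈ F.sets) s) {i k l : ℕ} (hi : i ∈ s) (hk : k ∈ s) (hl : l ∈ s) (hki : k ≠ i)
    (hli : l ≠ i) (hlk : l ≠ k) {c : ℕ} (h2 : ‖x i c‖ = 1 / 2) (h2' : ‖x k c‖ = 1 / 2) :
    x l c = 0 := by
  have hkmem : k ∈ s.erase i := Finset.mem_erase.2 ⟨hki, hk⟩
  have hk0 : x k c ≠ 0 := fun hx => by norm_num [hx] at h2'
  refine eq_zero_of_forall_unimodular_sum_eq_zero (u := (s.erase i).erase k)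
    (y := fun j => x j c) (fun ε hε => ?_) l
    (Finset.mem_erase.2 ⟨hlk, Finset.mem_erase.2 ⟨hli, hl⟩⟩)
  -- changing the sign of the `k`-th term changes the sum, hence changes its sign
  have hsum : ∀ z : 𝕜, ‖z‖ = 1 →
      z * x k c + ∑ j ∈ (s.erase i).erase k, ε j * x j c = x i c ∨
        z * x k c + ∑ j ∈ (s.erase i).erase k, ε j * x j c = -x i c := fun z hz => by
    have := h.sum_erase_eq_or_eq_neg hs hi h2 (ε := Function.update ε k z) fun j => by
      by_cases hj : j = k <;> simp [hj, hz, hε]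
    rwa [← Finset.add_sum_erase _ _ hkmem, Function.update_self, Finset.sum_congr rfl
      fun j hj => by rw [Function.update_of_ne (Finset.ne_of_mem_erase hj)]] at this
  set S := ∑ j ∈ (s.erase i).erase k, ε j * x j c
  have h20 : (2 : 𝕜) ≠ 0 := two_ne_zero
  rcases hsum 1 norm_one with h1 | h1 <;>
    rcases hsum (-1) (by rw [norm_neg, norm_one]) with h3 | h3
  · exact absurd (mul_left_cancel₀ h20 (by linear_combination h1 - h3 : 2 * x k c = 2 * 0)) hk0
  · exact mul_left_cancel₀ h20 (by linear_combination h1 + h3 : 2 * S = 2 * 0)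
  · exact mul_left_cancel₀ h20 (by linear_combination h1 + h3 : 2 * S = 2 * 0)
  · exact absurd (mul_left_cancel₀ h20 (by linear_combination h1 - h3 : 2 * x k c = 2 * 0)) hk0

/-- Take a member `P` of `F` that is maximal among those in which `i` is the only index with modulus
`1 / 2` at `c`. A maximal member of `F` above `P` contains a second such index `k`. By spreading,
`k` may be replaced by any large `m`; if `m` were not such an index, `P` could be enlarged by `m`.
-/
theorem exists_ge_norm_eq_half (h : MapsMaximal F G x) (hF : F.IsRegular) {i c : ℕ}
    (h2 : ‖x i c‖ = 1 / 2) (N : ℕ) : ∃ m ≥ N, ‖x m c‖ = 1 / 2 := by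
  by_contra! hN
  obtain ⟨P, -, hP⟩ := exists_maximal_superset hF.compact (F.singleton_mem i)
    (p := fun s => i ∈ s ∧ ∀ j ∈ s, j ≠ i → ‖x j c‖ ≠ 1 / 2) (by simp)
  obtain ⟨s, hPs, hs⟩ := exists_maximal hF.compact hP.1.1
  obtain ⟨k, hks, hki, hk⟩ := h.exists_ne_norm_eq_half hs (hPs hP.1.2.1) h2
  have hkP : k ∉ P := fun hkP => hP.1.2.2 k hkP hki hk
  let m := max (max N k) (P.sup id + 1)
  have hmP : m ∉ P := fun hm => by
    have : m ≤ P.sup id := Finset.le_sup (f := id) hm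
    have : P.sup id + 1 ≤ m := le_max_right _ _
    omega
  have hkm : k ≤ m := (le_max_right _ _).trans (le_max_left _ _)
  have hNm : N ≤ m := (le_max_left _ _).trans (le_max_left _ _)
  have hmem : insert m P ∈ F.sets :=
    hF.spreading _ (hF.hereditary _ hs.1 _ (Finset.insert_subset hks hPs)) _
      ((isSpread_refl P).insert hkP hmP hkm)
  refine hmP (hP.2 ⟨hmem, Finset.mem_insert_of_mem hP.1.2.1, fun j hj hji => ?_⟩
    (Finset.subset_insert _ _) (Finset.mem_insert_self _ _))
  rcases Finset.mem_insert.1 hj with rfl | hj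
  · exact hN _ hNm
  · exact hP.1.2.2 j hj hji

/-- A member with three elements could be spread to three indices of modulus `1 / 2` at `c`. -/
theorem card_le_two_of_norm_eq_half (h : MapsMaximal F G x) (hF : F.IsRegular) {i c : ℕ}
    (h2 : ‖x i c‖ = 1 / 2) {t : Finset ℕ} (ht : t ∈ F.sets) : t.card ≤ 2 := by
  by_contra! hcard
  obtain ⟨u, hut, hu⟩ := Finset.exists_subset_card_eq (show 3 ≤ t.card from hcard)
  obtain ⟨a, b, d, hab, had, hbd, rfl⟩ := Finset.card_eq_three.1 hu
  obtain ⟨p, hp, hp2⟩ := h.exists_ge_norm_eq_half hF h2 (max a (max b d))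
  obtain ⟨q, hq, hq2⟩ := h.exists_ge_norm_eq_half hF h2 (p + 1)
  obtain ⟨r, hr, hr2⟩ := h.exists_ge_norm_eq_half hF h2 (q + 1)
  have hpqr : IsSpread {a, b, d} {p, q, r} := by
    have h1 : IsSpread {d} {r} := by
      simpa using (isSpread_refl ∅).insert (a := d) (b := r) (by simp) (by simp) (by omega)
    refine (h1.insert (a := b) (b := q) (by simpa) ?_ (by omega)).insert (by simp [hab, had]) ?_
      (by omega)
    · simp only [Finset.mem_singleton]
      omega
    · simp only [Finset.mem_insert, Finset.mem_singleton]
      omega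
  obtain ⟨s, hs, hsmax⟩ := exists_maximal hF.compact
    (hF.spreading _ (hF.hereditary _ ht _ hut) _ hpqr)
  have h0 := h.eq_zero_of_norm_eq_half hsmax (i := p) (k := q) (l := r) (hs (by simp))
    (hs (by simp)) (hs (by simp)) (by omega) (by omega) (by omega) hp2 hq2
  norm_num [h0] at hr2

theorem pair_dichotomy (h : MapsMaximal F G x) {m n : ℕ} (hmn : m ≠ n)
    (hs : Maximal (· ∈ F.sets) {m, n}) (c : ℕ) :
    x m c * x n c = 0 ∨ ‖x m c‖ = 1 / 2 ∧ (x n c = x m c ∨ x n c = -x m c) := by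
  have := h.mul_sum_erase_eq_zero_or hs (i := m) (by simp) (ε := fun _ => 1)
    (fun _ => norm_one) c
  rwa [Finset.erase_insert (by simpa using hmn), Finset.sum_singleton, one_mul] at this

theorem exists_norm_add_eq (h : MapsMaximal F G x) {m n : ℕ} (hmn : m ≠ n)
    (hs : Maximal (· ∈ F.sets) {m, n}) : ∃ t, Maximal (· ∈ G.sets) t ∧
      ∀ c, ‖x m c + x n c‖ = if c ∈ t then 1 else 0 := by
  simpa [Finset.sum_pair hmn] using h _ hs (fun _ => 1) fun _ => norm_one

theorem exists_norm_sub_eq (h : MapsMaximal F G x) {m n : ℕ} (hmn : m ≠ n)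
    (hs : Maximal (· ∈ F.sets) {m, n}) : ∃ t, Maximal (· ∈ G.sets) t ∧
      ∀ c, ‖x m c - x n c‖ = if c ∈ t then 1 else 0 := by
  have := h _ hs (Function.update (fun _ => 1) n (-1)) fun j => by
      by_cases hj : j = n <;> simp [hj]
  simpa [Finset.sum_pair hmn, Function.update_of_ne hmn, ← sub_eq_add_neg] using this

/-- Coordinates of modulus `1 / 2` do not occur. If they did, all members of `F` would have at most
two elements, and all pairs of large indices would be maximal members. Among infinitely many indices
two, `m` and `m'`, agree at all coordinates of modulus `1 / 2`, so that the support of `x m - x m'`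
is a proper subset of the support of `x m + x m'`. -/
theorem norm_ne_half (h : MapsMaximal F G x) (hF : F.IsRegular) (i c : ℕ) :
    ‖x i c‖ ≠ 1 / 2 := by
  intro h2
  obtain ⟨s, hs, hsmax⟩ := exists_maximal hF.compact (F.singleton_mem i)
  have his : i ∈ s := hs (by simp)
  obtain ⟨k, hks, hki, -⟩ := h.exists_ne_norm_eq_half hsmax his h2
  have hpair : ∀ m n, m ≠ n → i ≤ m → k ≤ n → Maximal (· ∈ F.sets) {m, n} := fun m n hmn hm hn => by
    refine ⟨hF.spreading {i, k} (hF.hereditary _ hsmax.1 _ ?_) _ ?_, fun t ht hsub => ?_⟩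
    · exact Finset.insert_subset his (by simpa using hks)
    · have h1 : IsSpread {k} {n} := by
        simpa using (isSpread_refl ∅).insert (a := k) (b := n) (by simp) (by simp) hn
      exact h1.insert (by simpa using hki.symm) (by simpa using hmn) hm
    · refine (Finset.eq_of_subset_of_card_le hsub ?_).ge
      rw [Finset.card_pair hmn]
      exact h.card_le_two_of_norm_eq_half hF h2 ht
  obtain ⟨m₀, hm₀, hm₀2⟩ := h.exists_ge_norm_eq_half hF h2 (max i k)
  have hmax : ∀ m n, m ≠ n → m₀ ≤ m → m₀ ≤ n → Maximal (· ∈ F.sets) {m, n} := fun m n hmn hm hn =>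
    hpair m n hmn (by omega) (by omega)
  obtain ⟨t, -, ht⟩ := h.exists_norm_add_eq m₀.succ_ne_self.symm
    (hmax m₀ (m₀ + 1) (by omega) le_rfl (by omega))
  obtain ⟨t', -, ht'⟩ := h.exists_norm_sub_eq m₀.succ_ne_self.symm
    (hmax m₀ (m₀ + 1) (by omega) le_rfl (by omega))
  have hsupp : ∀ e, x m₀ e ≠ 0 → e ∈ t ∪ t' := fun e he => by
    by_contra hmem
    rw [Finset.mem_union, not_or] at hmem
    have h1 := ht e
    have h3 := ht' e
    rw [if_neg hmem.1, norm_eq_zero] at h1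
    rw [if_neg hmem.2, norm_eq_zero] at h3
    exact he (mul_left_cancel₀ two_ne_zero
      (by linear_combination h1 + h3 : (2 : 𝕜) * x m₀ e = 2 * 0))
  -- two later vectors with the same pattern of signs relative to `x m₀`
  obtain ⟨n, n', hne, hpat⟩ := Finite.exists_ne_map_eq_of_infinite
    fun n : ℕ => fun e : ↥(t ∪ t') => (x (m₀ + 1 + n) e = x m₀ e)
  generalize hm : m₀ + 1 + n = m at hpat
  generalize hm' : m₀ + 1 + n' = m' at hpat
  have hmm : m ≠ m' := by omega
  have hstep : ∀ m, m₀ < m → ∀ e, ‖x m e‖ = 1 / 2 → x m e = x m₀ e ∨ x m e = -x m₀ e :=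
    fun m hm e he => by
      have hmx := hmax m₀ m hm.ne le_rfl hm.le
      rcases h.pair_dichotomy hm.ne hmx e with h0 | h0
      · rcases mul_eq_zero.1 h0 with h0 | h0
        · obtain ⟨u, -, hu⟩ := h.exists_norm_add_eq hm.ne hmx
          have := hu e
          rw [h0, zero_add, he] at this
          split_ifs at this <;> norm_num at this
        · norm_num [h0] at he
      · exact h0.2
  have hagree : ∀ e, ‖x m e‖ = 1 / 2 → ‖x m' e‖ = 1 / 2 → x m e = x m' e := fun e he he' => by
    have h1 := hstep m (by omega) e he
    have h3 := hstep m' (by omega) e he'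
    have h0 : x m₀ e ≠ 0 := fun h0 => by
      rw [h0, neg_zero, or_self] at h1
      norm_num [h1] at he
    have hiff : x m e = x m₀ e ↔ x m' e = x m₀ e := by
      simpa using congrFun hpat ⟨e, hsupp e h0⟩
    rcases h1 with h1 | h1
    · rw [hiff.1 h1, h1]
    · rcases h3 with h3 | h3
      · rw [hiff.2 h3, h3]
      · rw [h1, h3]
  have hMax := hmax m m' hmm (by omega) (by omega)
  obtain ⟨T, hT, hTn⟩ := h.exists_norm_add_eq hmm hMax
  obtain ⟨T', hT', hTn'⟩ := h.exists_norm_sub_eq hmm hMax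
  have hsub : T' ⊆ T := fun e he => by
    by_contra heT
    have h1 := hTn e
    have h3 := hTn' e
    rw [if_neg heT, norm_eq_zero] at h1
    rw [if_pos he] at h3
    rcases h.pair_dichotomy hmm hMax e with h0 | ⟨h0, -⟩
    · have hz : x m e = 0 ∧ x m' e = 0 := by
        rcases mul_eq_zero.1 h0 with h0 | h0 <;> simpa [h0] using h1
      norm_num [hz] at h3
    · have hneg : x m' e = -x m e := (neg_eq_of_add_eq_zero_right h1).symm
      rw [hagree e h0 (by rw [hneg, norm_neg, h0]), sub_self] at h3
      norm_num at h3
  have hhalf : ∀ n, m₀ < n → ‖x n c‖ = 1 / 2 := fun n hn => by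
    obtain ⟨l, hl, hlm, hl2⟩ := h.exists_ne_norm_eq_half (hmax m₀ n hn.ne le_rfl hn.le)
      (by simp) hm₀2
    rcases Finset.mem_insert.1 hl with hl | hl
    · exact absurd hl hlm
    · rwa [← Finset.mem_singleton.1 hl]
  have hc := hhalf m (by omega)
  have heq := hagree c hc (hhalf m' (by omega))
  have h1 := hTn c
  have h3 := hTn' c
  rw [← heq, ← two_mul, norm_mul, RCLike.norm_two, hc] at h1
  rw [heq, sub_self, norm_zero] at h3
  have hcT : c ∈ T := by
    by_contra hcT
    norm_num [hcT] at h1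
  have hcT' : c ∉ T' := fun hcT' => by norm_num [hcT'] at h3
  exact hcT' (hT'.2 hT.1 hsub hcT)

theorem eq_zero_of_ne_zero (h : MapsMaximal F G x) (hF : F.IsRegular) {s : Finset ℕ}
    (hs : s ∈ F.sets) {i j : ℕ} (hi : i ∈ s) (hj : j ∈ s) (hji : j ≠ i) {c : ℕ} (h0 : x i c ≠ 0) :
    x j c = 0 := by
  obtain ⟨t, hst, ht⟩ := exists_maximal hF.compact hs
  exact h.eq_zero_of_norm_ne_half ht (hst hi) (hst hj) hji h0 (h.norm_ne_half hF i c)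

theorem exists_mem_of_ne_zero (h : MapsMaximal F G x) (hF : F.IsRegular) {s : Finset ℕ}
    (hs : s ∈ F.sets) : ∃ t ∈ G.sets, ∀ i ∈ s, ∀ c, x i c ≠ 0 → c ∈ t := by
  obtain ⟨u, hsu, hu⟩ := exists_maximal hF.compact hs
  obtain ⟨t, ht, hsum⟩ := h u hu (fun _ => 1) fun _ => norm_one
  refine ⟨t, ht.1, fun i hi c hc => by_contra fun hct => hc ?_⟩
  have := hsum c
  rw [if_neg hct, norm_eq_zero, Finset.sum_eq_single_of_mem i (hsu hi), one_mul] at this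
  · exact this
  · intro j hj hji
    rw [h.eq_zero_of_ne_zero hF hu.1 (hsu hi) hj hji hc, mul_zero]

theorem exists_mul_ne_zero (hx : MapsMaximal F G x) (hF : F.IsRegular)
    (hxy : IsLeftInverse x y) (i : ℕ) : ∃ c, x i c ≠ 0 ∧ y c i ≠ 0 := by
  obtain ⟨t, -, hxt⟩ := hx.exists_mem_of_ne_zero hF (F.singleton_mem i)
  have hone := hxy i t (hxt i (Finset.mem_singleton_self i)) i
  rw [if_pos rfl] at hone
  obtain ⟨c, -, hc⟩ := Finset.exists_ne_zero_of_sum_ne_zero (hone ▸ one_ne_zero)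
  exact ⟨c, left_ne_zero_of_mul hc, right_ne_zero_of_mul hc⟩

/-- The row `x i` is supported on a single point. -/
theorem exists_forall_ne_zero_iff (hx : MapsMaximal F G x) (hy : MapsMaximal G F y)
    (hF : F.IsRegular) (hG : G.IsRegular)
    (hxy : IsLeftInverse x y) (hyx : IsLeftInverse y x) (i : ℕ) :
    ∃ c, x i c ≠ 0 ∧ y c i ≠ 0 ∧ ∀ c', x i c' ≠ 0 → c' = c := by
  obtain ⟨t, ht, hxt⟩ := hx.exists_mem_of_ne_zero hF (F.singleton_mem i)
  replace hxt := hxt i (Finset.mem_singleton_self i)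
  obtain ⟨c, hc, hci⟩ := hx.exists_mul_ne_zero hF hxy i
  refine ⟨c, hc, hci, fun c' hc' => by_contra fun hne => ?_⟩
  obtain ⟨k, hk, -⟩ := hy.exists_mul_ne_zero hG hyx c'
  -- in column `k` only `y c'` contributes, so that `k = i`; but column `i` belongs to `y c`
  have hki : k = i := by
    by_contra hki
    have := hxy i t hxt k
    rw [if_neg hki, Finset.sum_eq_single_of_mem c' (hxt c' hc')] at this
    · exact mul_ne_zero hc' hk this
    · intro d hd hdc
      rw [hy.eq_zero_of_ne_zero hG ht (hxt c' hc') hd hdc hk, mul_zero]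
  rw [hki] at hk
  exact hk (hy.eq_zero_of_ne_zero hG ht (hxt c hc) (hxt c' hc') hne hci)

theorem piHomeomorphic (hx : MapsMaximal F G x) (hy : MapsMaximal G F y)
    (hF : F.IsRegular) (hG : G.IsRegular)
    (hxy : IsLeftInverse x y) (hyx : IsLeftInverse y x) : F.PiHomeomorphic G := by
  choose π hπ0 hπy hπ using hx.exists_forall_ne_zero_iff hy hF hG hxy hyx
  choose ρ hρ0 hρx hρ using hy.exists_forall_ne_zero_iff hx hG hF hyx hxy
  have hρπ : ∀ i, ρ (π i) = i := fun i => (hρ _ _ (hπy i)).symm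
  have hπρ : ∀ c, π (ρ c) = c := fun c => (hπ _ _ (hρx c)).symm
  refine ⟨⟨π, ρ, hρπ, hπρ⟩, Set.Subset.antisymm (fun t ht => ?_) ?_⟩
  · obtain ⟨s, hs, hts⟩ := hy.exists_mem_of_ne_zero hG ht
    refine ⟨t.image ρ, hF.hereditary s hs _ (Finset.image_subset_iff.2 fun c hc =>
      hts c hc _ (hρ0 c)), ?_⟩
    simp [Finset.image_image, Function.comp_def, hπρ]
  · rintro _ ⟨s, hs, rfl⟩
    obtain ⟨t, ht, hst⟩ := hx.exists_mem_of_ne_zero hF hs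
    exact hG.hereditary t ht _ (Finset.image_subset_iff.2 fun i hi => hst i hi _ (hπ0 i))

end MapsMaximal

end OmegaFamily

/-! ### The unit ball of the dual and its extreme points -/

namespace OmegaFamily

variable {𝕜 : Type*} [RCLike 𝕜] {F G : OmegaFamily}

/-- The vector `z • e i` of `c₀₀(ω)`. -/
noncomputable def single (F : OmegaFamily) (i : ℕ) (z : 𝕜) : F.C00 𝕜 := Finsupp.single i z

theorem single_apply (i j : ℕ) (z : 𝕜) : (F.single i z) j = if j = i then z else 0 := by
  exact (Finsupp.single_apply (a := i) (b := z) (a' := j)).trans (by simp [eq_comm])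

/-- The support of a vector of `c₀₀(ω)`. -/
def supp (x : F.C00 𝕜) : Finset ℕ := Finsupp.support (M := 𝕜) x

theorem norm_le_of_forall {x : F.C00 𝕜} {C : ℝ} (h : ∀ s ∈ F.sets, ∑ i ∈ s, ‖x i‖ ≤ C) :
    ‖x‖ ≤ C := by
  rw [norm_def]
  exact ciSup_le fun s => h s.1 s.2

/-- The linear form `x ↦ ∑ i, x i * a i` on `c₀₀(ω)`, for an arbitrary sequence `a`. -/
noncomputable def pairing (a : ℕ → 𝕜) : F.C00 𝕜 →ₗ[𝕜] 𝕜 := Finsupp.linearCombination 𝕜 a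

theorem pairing_apply (a : ℕ → 𝕜) (x : F.C00 𝕜) : pairing a x = ∑ i ∈ supp x, x i * a i :=
  Finsupp.linearCombination_apply 𝕜 (v := a) x

theorem pairing_single (a : ℕ → 𝕜) (i : ℕ) (z : 𝕜) : pairing a (F.single i z) = z * a i :=
  Finsupp.linearCombination_single 𝕜 z i

/-- The coordinates `f (e i)` of a functional on `X_F`. -/
noncomputable def coord (f : StrongDual 𝕜 (F.CombSpace 𝕜)) (i : ℕ) : 𝕜 :=
  f (F.single i 1 : F.C00 𝕜)

theorem apply_coe (f : StrongDual 𝕜 (F.CombSpace 𝕜)) (x : F.C00 𝕜) :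
    f (x : F.CombSpace 𝕜) = pairing (coord f) x := by
  have : (f.toLinearMap ∘ₗ (Completion.toComplL (𝕜 := 𝕜) (E := F.C00 𝕜)).toLinearMap) =
      pairing (coord f) := by
    refine Finsupp.lhom_ext' (M := 𝕜) fun i => LinearMap.ext_ring ?_
    exact ((pairing_single (F := F) (coord f) i 1).trans (one_mul _)).symm
  exact LinearMap.congr_fun this x

theorem coord_injective : Function.Injective
    (coord : StrongDual 𝕜 (F.CombSpace 𝕜) → ℕ → 𝕜) := by
  intro f g h
  refine DFunLike.coe_injective (Completion.ext f.continuous g.continuous fun x => ?_)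
  rw [apply_coe, apply_coe, h]

@[simp] theorem coord_add (f g : StrongDual 𝕜 (F.CombSpace 𝕜)) :
    coord (f + g) = coord f + coord g := rfl

@[simp] theorem coord_sub (f g : StrongDual 𝕜 (F.CombSpace 𝕜)) :
    coord (f - g) = coord f - coord g := rfl

@[simp] theorem coord_zero : coord (0 : StrongDual 𝕜 (F.CombSpace 𝕜)) = 0 := rfl

@[simp] theorem coord_smul (z : 𝕜) (f : StrongDual 𝕜 (F.CombSpace 𝕜)) :
    coord (z • f) = z • coord f := rfl

theorem coord_sum {ι : Type*} (u : Finset ι) (f : ι → StrongDual 𝕜 (F.CombSpace 𝕜)) (c : ℕ) :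
    coord (∑ i ∈ u, f i) c = ∑ i ∈ u, coord (f i) c :=
  sum_apply u f _

/-- The coordinate sequences of the functionals in the dual unit ball. -/
def dualBall (F : OmegaFamily) (𝕜 : Type*) [RCLike 𝕜] : Set (ℕ → 𝕜) :=
  {a | ∀ x : F.C00 𝕜, ‖pairing a x‖ ≤ ‖x‖}

theorem coord_mem_dualBall {f : StrongDual 𝕜 (F.CombSpace 𝕜)} :
    coord f ∈ F.dualBall 𝕜 ↔ ‖f‖ ≤ 1 := by
  constructor
  · intro h
    refine f.opNorm_le_bound zero_le_one fun x => ?_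
    rw [one_mul]
    induction x using Completion.induction_on with
    | hp => exact isClosed_le (by fun_prop) (by fun_prop)
    | ih x =>
      rw [apply_coe, Completion.norm_coe]
      exact h x
  · intro h x
    rw [← apply_coe, ← Completion.norm_coe x]
    exact (f.le_opNorm _).trans (mul_le_of_le_one_left (norm_nonneg _) h)

/-- A sequence of the dual ball defines a bounded form on `c₀₀(ω)`, which extends to the completion.
-/
theorem exists_coord_eq {a : ℕ → 𝕜} (ha : a ∈ F.dualBall 𝕜) :
    ∃ f : StrongDual 𝕜 (F.CombSpace 𝕜), coord f = a := by
  let g : F.C00 𝕜 →L[𝕜] 𝕜 := (pairing a).mkContinuous 1 fun x => by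
    rw [one_mul]
    exact ha x
  refine ⟨g.extend (Completion.toComplL (𝕜 := 𝕜) (E := F.C00 𝕜)), funext fun i => ?_⟩
  refine (g.extend_eq (e := Completion.toComplL) Completion.denseRange_coe
    (Completion.isUniformInducing_coe _) (F.single i 1)).trans ?_
  exact (pairing_single a i 1).trans (one_mul _)

/-- The sequence `a` has modulus one on `s` and vanishes elsewhere. -/
def IsUnimodularOn (s : Finset ℕ) (a : ℕ → 𝕜) : Prop := ∀ i, ‖a i‖ = if i ∈ s then 1 else 0

theorem IsUnimodularOn.mem_dualBall {s : Finset ℕ} (hs : s ∈ F.sets) {a : ℕ → 𝕜}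
    (ha : IsUnimodularOn s a) : a ∈ F.dualBall 𝕜 := by
  intro x
  rw [pairing_apply]
  refine (norm_sum_le _ _).trans (le_trans ?_ (F.sum_le_norm 𝕜 x hs))
  simp_rw [norm_mul, ha _, mul_ite, mul_one, mul_zero]
  rw [← Finset.sum_filter]
  exact Finset.sum_le_sum_of_subset_of_nonneg (fun i hi => (Finset.mem_filter.1 hi).2)
    fun _ _ _ => norm_nonneg _

/-- The vector of `c₀₀(ω)` that agrees with `u` on `s` and vanishes elsewhere. -/
noncomputable def vec (F : OmegaFamily) (s : Finset ℕ) (u : ℕ → 𝕜) : F.C00 𝕜 :=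
  ∑ i ∈ s, F.single i (u i)

theorem vec_apply (s : Finset ℕ) (u : ℕ → 𝕜) (j : ℕ) :
    F.vec s u j = if j ∈ s then u j else 0 := by
  have : F.vec s u j = ∑ i ∈ s, F.single i (u i) j := Finsupp.finsetSum_apply (N := 𝕜) s _ j
  rw [this]
  simp_rw [single_apply]
  exact Finset.sum_ite_eq s j u

theorem pairing_vec (a : ℕ → 𝕜) (s : Finset ℕ) (u : ℕ → 𝕜) :
    pairing a (F.vec s u) = ∑ i ∈ s, u i * a i := by
  rw [vec, map_sum]
  exact Finset.sum_congr rfl fun i _ => pairing_single a i _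

theorem norm_vec_le {s : Finset ℕ} {u : ℕ → 𝕜} {C : ℝ}
    (h : ∀ t ∈ F.sets, ∑ i ∈ t with i ∈ s, ‖u i‖ ≤ C) : ‖F.vec s u‖ ≤ C := by
  refine norm_le_of_forall fun t ht => le_trans (le_of_eq ?_) (h t ht)
  rw [Finset.sum_filter]
  refine Finset.sum_congr rfl fun i _ => ?_
  rw [vec_apply]
  split_ifs <;> simp

theorem norm_apply_le_one {a : ℕ → 𝕜} (ha : a ∈ F.dualBall 𝕜) (i : ℕ) : ‖a i‖ ≤ 1 := by
  have h := ha (F.vec {i} fun _ => 1)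
  rw [pairing_vec, Finset.sum_singleton, one_mul] at h
  refine h.trans (norm_vec_le fun t _ => ?_)
  simp only [Finset.mem_singleton, Finset.sum_filter, norm_one]
  rw [Finset.sum_ite_eq' t i fun _ => (1 : ℝ)]
  split_ifs <;> simp

/-- Sequences that are unimodular on a maximal member are extreme in the dual ball. -/
theorem eq_zero_of_add_mem_dualBall {s : Finset ℕ} (hs : Maximal (· ∈ F.sets) s)
    {a d : ℕ → 𝕜} (ha : IsUnimodularOn s a) (h1 : a + d ∈ F.dualBall 𝕜)
    (h2 : a - d ∈ F.dualBall 𝕜) : d = 0 := by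
  have hds : ∀ i ∈ s, d i = 0 := fun i hi => by
    have h3 : ‖a i + d i‖ ≤ 1 := norm_apply_le_one h1 i
    have h4 : ‖a i - d i‖ ≤ 1 := norm_apply_le_one h2 i
    have h5 := parallelogram_law_with_norm 𝕜 (a i) (d i)
    have h6 := ha i
    rw [if_pos hi] at h6
    rw [h6] at h5
    have h7 : ‖d i‖ * ‖d i‖ ≤ 0 := by
      nlinarith [norm_nonneg (a i + d i), norm_nonneg (a i - d i)]
    exact norm_eq_zero.1 (mul_self_eq_zero.1 (h7.antisymm (mul_self_nonneg _)))
  funext j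
  by_cases hj : j ∈ s
  · exact hds j hj
  have haj : a j = 0 := by
    have := ha j
    rwa [if_neg hj, norm_eq_zero] at this
  obtain ⟨z, hz, hzd⟩ := RCLike.exists_norm_eq_mul_self (d j)
  -- a vector of norm `#s` at which `a + d` takes the value `#s + ‖d j‖`
  let u : ℕ → 𝕜 := fun i => if i = j then z else conj (a i)
  have hus : ∀ i ∈ s, u i = conj (a i) := fun i hi => if_neg (ne_of_mem_of_not_mem hi hj)
  have huj : u j = z := if_pos rfl
  have hu : ∀ i ∈ insert j s, ‖u i‖ = 1 := fun i hi => by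
    rcases Finset.mem_insert.1 hi with rfl | hi
    · rw [huj, hz]
    · rw [hus i hi, RCLike.norm_conj, ha i, if_pos hi]
  have hnorm : ‖F.vec (insert j s) u‖ ≤ s.card := norm_vec_le fun t ht => by
    rw [Finset.sum_congr rfl fun i hi => hu i (Finset.mem_filter.1 hi).2, Finset.sum_const,
      nsmul_one, Nat.cast_le]
    refine Nat.lt_succ_iff.1 ?_
    rw [Nat.succ_eq_add_one, ← Finset.card_insert_of_notMem hj]
    refine Finset.card_lt_card ⟨fun i hi => (Finset.mem_filter.1 hi).2, fun hsub => hj ?_⟩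
    have hst : insert j s ⊆ t := fun i hi => (Finset.mem_filter.1 (hsub hi)).1
    exact hs.2 ht ((Finset.subset_insert _ _).trans hst) (hst (Finset.mem_insert_self _ _))
  have hval : pairing (a + d) (F.vec (insert j s) u) = ((s.card + ‖d j‖ : ℝ) : 𝕜) := by
    rw [pairing_vec, Finset.sum_insert hj, huj, Pi.add_apply, haj, zero_add, ← hzd, add_comm,
      Finset.sum_congr rfl (g := fun _ => (1 : 𝕜)) fun i hi => ?_]
    · simp
    · rw [hus i hi, Pi.add_apply, hds i hi, add_zero, RCLike.conj_mul, ha i, if_pos hi]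
      simp
  have := (h1 (F.vec (insert j s) u)).trans hnorm
  rw [hval, RCLike.norm_ofReal] at this
  exact norm_le_zero_iff.1 (by linarith [le_abs_self ((s.card : ℝ) + ‖d j‖)])

/-- The sequences that are unimodular on a member of `F` and vanish elsewhere. -/
def signedSets (F : OmegaFamily) (𝕜 : Type*) [RCLike 𝕜] : Set (ℕ → 𝕜) :=
  {a | ∃ s ∈ F.sets, IsUnimodularOn s a}

/-- The set is a continuous image of the product of the family, as a subset of `2^ω`, with a power
of the unit sphere of `𝕜`. -/
theorem isCompact_signedSets (hF : F.IsCompactFamily) : IsCompact (F.signedSets 𝕜) := by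
  have hsph : IsCompact (Set.univ.pi fun _ : ℕ => Metric.sphere (0 : 𝕜) 1) :=
    isCompact_univ_pi fun _ => isCompact_sphere 0 1
  have h := (IsCompact.prod hF hsph).image
    (f := fun p : (ℕ → Bool) × (ℕ → 𝕜) => fun i => bif p.1 i then p.2 i else 0) ?_
  · convert h using 1
    ext a
    constructor
    · rintro ⟨s, hs, ha⟩
      refine ⟨(charFun s, fun i => if i ∈ s then a i else 1), ⟨⟨s, hs, rfl⟩, ?_⟩, ?_⟩
      · intro i _
        by_cases hi : i ∈ s <;> simp [hi, ha i]
      · funext i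
        by_cases hi : i ∈ s
        · simp [charFun, hi]
        · have := ha i
          rw [if_neg hi, norm_eq_zero] at this
          simp [charFun, hi, this]
    · rintro ⟨⟨_, u⟩, ⟨⟨s, hs, rfl⟩, hu⟩, rfl⟩
      refine ⟨s, hs, fun i => ?_⟩
      have : ‖u i‖ = 1 := by simpa using hu i trivial
      by_cases hi : i ∈ s <;> simp [charFun, hi, this]
  · refine continuous_pi fun i => ?_
    have : Continuous fun q : Bool × 𝕜 => bif q.1 then q.2 else 0 := by
      refine continuous_prod_of_discrete_left.2 fun b => ?_
      cases b <;> simp <;> fun_prop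
    exact this.comp (f := fun p : (ℕ → Bool) × (ℕ → 𝕜) => (p.1 i, p.2 i)) (by fun_prop)

theorem convex_dualBall : Convex ℝ (F.dualBall 𝕜) := by
  intro a ha b hb p q hp hq hpq x
  have : pairing (p • a + q • b) x = p • pairing a x + q • pairing b x := by
    simp only [pairing_apply, Finset.smul_sum, ← Finset.sum_add_distrib, Pi.add_apply,
      Pi.smul_apply, mul_add, mul_smul_comm]
  rw [this]
  calc ‖p • pairing a x + q • pairing b x‖ ≤ p * ‖pairing a x‖ + q * ‖pairing b x‖ := by
        refine (norm_add_le _ _).trans (le_of_eq ?_)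
        rw [norm_smul, norm_smul, Real.norm_of_nonneg hp, Real.norm_of_nonneg hq]
    _ ≤ p * ‖x‖ + q * ‖x‖ := by gcongr <;> first | exact ha x | exact hb x
    _ = ‖x‖ := by rw [← add_mul, hpq, one_mul]

theorem isCompact_dualBall : IsCompact (F.dualBall 𝕜) := by
  refine (isCompact_univ_pi fun _ : ℕ => isCompact_closedBall (0 : 𝕜) 1).of_isClosed_subset ?_
    fun a ha i _ => by simpa using norm_apply_le_one ha i
  have : F.dualBall 𝕜 = ⋂ x : F.C00 𝕜, {a | ‖pairing a x‖ ≤ ‖x‖} := by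
    ext a
    simp [dualBall]
  rw [this]
  refine isClosed_iInter fun x => isClosed_le ?_ continuous_const
  simp_rw [pairing_apply]
  fun_prop

/-- The set `signedSets` norms `c₀₀(ω)`, and a continuous functional on `ℕ → 𝕜` is the limit of its
restrictions to finitely many coordinates; so a functional bounded by `r` on `signedSets` is bounded
by `r` on the dual ball. -/
theorem dualBall_eq_closedConvexHull (hF : F.IsHereditary) :
    F.dualBall 𝕜 = closedConvexHull ℝ (F.signedSets 𝕜) := by
  refine Set.Subset.antisymm (fun a ha => ?_) (closedConvexHull_min ?_ convex_dualBall
    isCompact_dualBall.isClosed)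
  · by_contra hmem
    obtain ⟨f, r, hr, hra⟩ := RCLike.geometric_hahn_banach_closed_point (𝕜 := 𝕜)
      convex_closedConvexHull isClosed_closedConvexHull hmem
    set u : ℕ → 𝕜 := fun i => f (Pi.single i 1) with hu
    have hf : ∀ (b : ℕ → 𝕜) (s : Finset ℕ), f (∑ i ∈ s, Pi.single i (b i)) = ∑ i ∈ s, u i * b i :=
      fun b s => by
        rw [map_sum]
        refine Finset.sum_congr rfl fun i _ => ?_
        rw [hu, ← mul_one (b i), ← smul_eq_mul, Pi.single_smul, map_smul, smul_eq_mul, smul_eq_mul,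
          mul_one, mul_comm]
    have hnorm : ∀ s : Finset ℕ, ‖F.vec s u‖ ≤ r := fun s => norm_vec_le fun t ht => by
      choose z hz hzu using fun i => RCLike.exists_norm_eq_mul_self (u i)
      have hsum : ∀ i, (∑ j ∈ t with j ∈ s, Pi.single j (z j) : ℕ → 𝕜) i =
          if i ∈ t.filter (· ∈ s) then z i else 0 := fun i => by
        rw [Finset.sum_apply]
        exact Finset.sum_pi_single i z _
      have hK : (∑ i ∈ t with i ∈ s, Pi.single i (z i) : ℕ → 𝕜) ∈ F.signedSets 𝕜 := by
        refine ⟨t.filter (· ∈ s), hF t ht _ (Finset.filter_subset _ _), fun i => ?_⟩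
        rw [hsum]
        split_ifs
        · exact hz i
        · exact norm_zero
      have := hr _ (subset_closedConvexHull hK)
      rw [hf, Finset.sum_congr rfl fun i _ => (mul_comm _ _).trans (hzu i).symm,
        ← RCLike.ofReal_sum, RCLike.ofReal_re] at this
      exact this.le
    have hlim : Filter.Tendsto (fun s : Finset ℕ => ∑ i ∈ s, (Pi.single i (a i) : ℕ → 𝕜))
        Filter.atTop (nhds a) := by
      refine tendsto_pi_nhds.2 fun j => tendsto_const_nhds.congr' ?_
      filter_upwards [Filter.eventually_ge_atTop {j}] with s hs
      rw [Finset.sum_apply]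
      exact ((Finset.sum_pi_single j a s).trans (if_pos (hs (by simp)))).symm
    have hle := le_of_tendsto (((RCLike.continuous_re.comp f.continuous).tendsto a).comp hlim)
      (Filter.Eventually.of_forall fun s => show RCLike.re (f (∑ i ∈ s, Pi.single i (a i))) ≤ r by
        rw [hf, ← pairing_vec (F := F)]
        exact (RCLike.re_le_norm _).trans ((ha _).trans (hnorm s)))
    exact hra.not_ge hle
  · rintro a ⟨s, hs, ha⟩
    exact ha.mem_dualBall hs

/-- Extreme sequences of the dual ball are unimodular on a maximal member of the family. -/
theorem exists_maximal_of_extreme (hF : F.IsRegular) {a : ℕ → 𝕜} (ha : a ∈ F.dualBall 𝕜)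
    (h : ∀ d, a + d ∈ F.dualBall 𝕜 → a - d ∈ F.dualBall 𝕜 → d = 0) :
    ∃ s, Maximal (· ∈ F.sets) s ∧ IsUnimodularOn s a := by
  have hball := dualBall_eq_closedConvexHull (𝕜 := 𝕜) hF.hereditary
  have hmem : a ∈ F.signedSets 𝕜 :=
    (isCompact_signedSets hF.compact).mem_of_extreme_closedConvexHull
      (hball ▸ isCompact_dualBall) (hball ▸ ha) (hball ▸ h)
  obtain ⟨s, hs, hsa⟩ := hmem
  refine ⟨s, ⟨hs, fun t ht hst j hj => by_contra fun hjs => ?_⟩, hsa⟩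
  have haj : a j = 0 := by
    have := hsa j
    rwa [if_neg hjs, norm_eq_zero] at this
  have hins : insert j s ∈ F.sets := hF.hereditary t ht _ (Finset.insert_subset hj hst)
  have hz : ∀ z : 𝕜, ‖z‖ = 1 → a + Pi.single j z ∈ F.dualBall 𝕜 := fun z hz =>
    IsUnimodularOn.mem_dualBall hins fun i => by
      rcases eq_or_ne i j with rfl | hij
      · simp [haj, hz]
      · simp [hij, hsa i]
  have := congrFun (h (Pi.single j 1) (hz 1 norm_one) (by
    rw [sub_eq_add_neg, ← Pi.single_neg]
    exact hz (-1) (by rw [norm_neg, norm_one]))) j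
  simp at this

/-- Extreme points of the closed unit ball, in the form that avoids real scalars: `f` is not the
midpoint of a nontrivial segment in the ball. -/
def IsBallExtreme {E : Type*} [NormedAddCommGroup E] (f : E) : Prop :=
  ‖f‖ ≤ 1 ∧ ∀ d, ‖f + d‖ ≤ 1 → ‖f - d‖ ≤ 1 → d = 0

theorem IsBallExtreme.map {E E' : Type*} [NormedAddCommGroup E] [NormedAddCommGroup E']
    [NormedSpace 𝕜 E] [NormedSpace 𝕜 E'] {f : E} (hf : IsBallExtreme f) (T : E ≃ₗᵢ[𝕜] E') :
    IsBallExtreme (T f) := by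
  refine ⟨(T.norm_map f).trans_le hf.1, fun d h1 h2 => ?_⟩
  rw [← T.apply_symm_apply d, ← map_add, T.norm_map] at h1
  rw [← T.apply_symm_apply d, ← map_sub, T.norm_map] at h2
  rw [← T.apply_symm_apply d, hf.2 _ h1 h2, map_zero]

theorem isBallExtreme_iff (hF : F.IsRegular) (f : StrongDual 𝕜 (F.CombSpace 𝕜)) :
    IsBallExtreme f ↔ ∃ s, Maximal (· ∈ F.sets) s ∧ IsUnimodularOn s (coord f) := by
  constructor
  · rintro ⟨h1, h⟩
    refine exists_maximal_of_extreme hF (coord_mem_dualBall.2 h1) fun d hd hd' => ?_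
    obtain ⟨g, hg⟩ := exists_coord_eq hd
    obtain rfl : coord (g - f) = d := by rw [coord_sub, hg, add_sub_cancel_left]
    rw [h (g - f) (coord_mem_dualBall.1 hd) (coord_mem_dualBall.1 hd'), coord_zero]
  · rintro ⟨s, hs, hsf⟩
    refine ⟨coord_mem_dualBall.1 (hsf.mem_dualBall hs.1), fun d h1 h2 => coord_injective ?_⟩
    rw [← coord_mem_dualBall, coord_add] at h1
    rw [← coord_mem_dualBall, coord_sub] at h2
    rw [coord_zero]
    exact eq_zero_of_add_mem_dualBall hs hsf h1 h2

/-! ### Isometries of the duals -/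

theorem exists_coord_eq_single (F : OmegaFamily) (𝕜 : Type*) [RCLike 𝕜] (i : ℕ) :
    ∃ f : StrongDual 𝕜 (F.CombSpace 𝕜), coord f = Pi.single i 1 :=
  exists_coord_eq (IsUnimodularOn.mem_dualBall (F.singleton_mem i) fun j => by
    rcases eq_or_ne j i with rfl | hij <;> simp [*])

/-- The functional on `X_F` that extends the coordinate functional `x ↦ x i`. -/
noncomputable def dualBasis (F : OmegaFamily) (𝕜 : Type*) [RCLike 𝕜] (i : ℕ) :
    StrongDual 𝕜 (F.CombSpace 𝕜) :=
  (exists_coord_eq_single F 𝕜 i).choose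

@[simp] theorem coord_dualBasis (i : ℕ) : coord (F.dualBasis 𝕜 i) = Pi.single i 1 :=
  (exists_coord_eq_single F 𝕜 i).choose_spec

theorem coord_sum_smul_dualBasis (s : Finset ℕ) (b : ℕ → 𝕜) (c : ℕ) :
    coord (∑ i ∈ s, b i • F.dualBasis 𝕜 i) c = if c ∈ s then b c else 0 := by
  rw [coord_sum]
  simp [Pi.single_apply]

theorem mapsMaximal_coord (hF : F.IsRegular) (hG : G.IsRegular)
    (T : StrongDual 𝕜 (F.CombSpace 𝕜) ≃ₗᵢ[𝕜] StrongDual 𝕜 (G.CombSpace 𝕜)) :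
    MapsMaximal F G fun i => coord (T (F.dualBasis 𝕜 i)) := by
  intro s hs ε hε
  have hext : IsBallExtreme (∑ i ∈ s, ε i • F.dualBasis 𝕜 i) := by
    refine (isBallExtreme_iff hF _).2 ⟨s, hs, fun c => ?_⟩
    rw [coord_sum_smul_dualBasis]
    split_ifs
    · exact hε c
    · exact norm_zero
  obtain ⟨t, ht, htT⟩ := (isBallExtreme_iff hG _).1 (hext.map T)
  refine ⟨t, ht, fun c => ?_⟩
  rw [← htT c, map_sum, coord_sum]
  simp only [map_smul, coord_smul, Pi.smul_apply, smul_eq_mul]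

theorem isLeftInverse_coord
    (T : StrongDual 𝕜 (F.CombSpace 𝕜) ≃ₗᵢ[𝕜] StrongDual 𝕜 (G.CombSpace 𝕜)) :
    IsLeftInverse (fun i => coord (T (F.dualBasis 𝕜 i)))
      fun c => coord (T.symm (G.dualBasis 𝕜 c)) := by
  intro i t ht k
  have hT : T (F.dualBasis 𝕜 i) = ∑ c ∈ t, coord (T (F.dualBasis 𝕜 i)) c • G.dualBasis 𝕜 c := by
    refine coord_injective (funext fun c => ?_)
    rw [coord_sum_smul_dualBasis]
    split_ifs with hc
    · rfl
    · exact by_contra fun h => hc (ht c h)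
  have h2 := congrArg (fun f => coord (T.symm f) k) hT
  simp only [LinearIsometryEquiv.symm_apply_apply, map_sum, map_smul, coord_sum, coord_smul,
    Pi.smul_apply, smul_eq_mul, coord_dualBasis, Pi.single_apply] at h2
  exact h2.symm

theorem piHomeomorphic_of_dual_isometry (hF : F.IsRegular) (hG : G.IsRegular)
    (T : StrongDual 𝕜 (F.CombSpace 𝕜) ≃ₗᵢ[𝕜] StrongDual 𝕜 (G.CombSpace 𝕜)) :
    F.PiHomeomorphic G :=
  (mapsMaximal_coord hF hG T).piHomeomorphic (mapsMaximal_coord hG hF T.symm) hF hG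
    (isLeftInverse_coord T) (isLeftInverse_coord T.symm)

end OmegaFamily

/-- The isometry of dual spaces induced by an isometry. -/
noncomputable def LinearIsometryEquiv.strongDual {𝕜 E E' : Type*} [RCLike 𝕜]
    [NormedAddCommGroup E] [NormedAddCommGroup E'] [NormedSpace 𝕜 E] [NormedSpace 𝕜 E']
    (e : E ≃ₗᵢ[𝕜] E') : StrongDual 𝕜 E ≃ₗᵢ[𝕜] StrongDual 𝕜 E' where
  toLinearEquiv := (e.toContinuousLinearEquiv.arrowCongr (.refl 𝕜 𝕜)).toLinearEquiv
  norm_map' f := f.opNorm_comp_linearIsometryEquiv e.symm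

theorem corollary3p5 {𝕜 : Type*} [RCLike 𝕜] (F G : OmegaFamily)
    (hF : F.IsRegular) (hG : G.IsRegular) :
    List.TFAE [
      F = G,
      F.PiHomeomorphic G,
      Nonempty (F.CombSpace 𝕜 ≃ₗᵢ[𝕜] G.CombSpace 𝕜),
      Nonempty (StrongDual 𝕜 (F.CombSpace 𝕜) ≃ₗᵢ[𝕜] StrongDual 𝕜 (G.CombSpace 𝕜))] := by
  tfae_have 2 → 1 := fun h => h.eq hF.spreading hG.spreading
  tfae_have 1 → 3 := by
    rintro rfl
    exact ⟨.refl 𝕜 _⟩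
  tfae_have 3 → 4 := fun ⟨e⟩ => ⟨e.strongDual⟩
  tfae_have 4 → 2 := fun ⟨T⟩ => OmegaFamily.piHomeomorphic_of_dual_isometry hF hG T
  tfae_finish
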